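/- Let $V$ be a finite set and let all directed acyclic graphs (DAGs) be finite. For a DAG $G$ on $V$ write $\mathrm{pa}_G(v)=\{u : u\to v \text{ in } G\}$; a set $A\subseteq V$ is \emph{ancestral} in $G$ if $\mathrm{pa}_G(v)\subseteq A$ for all $v\in A$. The \emph{semi-graphoid} of $G$ is the set of triples $\langle A,B\mid C\rangle$ of subsets of $V$ such that $A$ and $B$ are separated by $C$ (every path from $A$ to $B$, possibly of length zero, meets $C$) in the moral graph of the subgraph of $G$ induced by the smallest ancestral set containing $A\cup B\cup C$; here the moral graph is the undirected skeleton with an edge added between any two vertices having a common child. Two DAGs on the same vertex set are \emph{Markov equivalent} if they have the same semi-graphoid, and a \emph{dagoid} is a Markov equivalence class $[G]$ of DAGs. A set $A$ is \emph{ancestral} in a dagoid $D$ if it is ancestral in some $G\in D$. For such a $G$, the \emph{induced subdagoid} $D_A$ is the class $[G_A]$ of the induced subgraph, and the \emph{remainder dagoid} $D_{V|A}$ is the class of the DAG on $V$ obtained from $G$ by replacing the edges inside $A$ by those of a complete DAG on $A$. The \emph{d-clique vector} of a DAG $G$ on $V$ is \[ t(G)=\sum_{v\in V}\bigl[\delta(\{v\}\cup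 \mathrm{pa}_G(v))-\delta(\mathrm{pa}_G(v))\bigr]+\delta(\varnothing)\in\mathbb{Z}^{2^V},\qquad \delta(A)=(\mathbf 1_{S=A})_{S\subseteq V}, \] and for a dagoid $D$, $t(D)$ denotes $t(G)$ for any $G\in D$. \textbf{Theorem.} Let $A$ be an ancestral set of a dagoid $D$ on $V$. Then $D_A$ and $D_{V|A}$ exist and \[ t(D)=[t(D_A)]^0+t(D_{V|A})-\delta(A), \] where $[\cdot]^0$ expands a vector indexed by the subsets of $A$ by zeroes to one indexed by the subsets of $V$. The identity holds for every choice of the graphs that define $D_A$ and $D_{V|A}$, and of the representatives of $D$, $D_A$ and $D_{V|A}$ at which $t$ is evaluated. -/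

import Mathlib

/-- A directed acyclic graph on the vertex set `V`: a directed edge relation (`Adj u v` is the edge
`u → v`) that admits a compatible well-ordering of `V`. -/
@[ext]
structure DAG (V : Type*) where
  Adj : V → V → Prop
  acyclic : ∃ r : V → V → Prop, IsWellOrder V r ∧ ∀ u v, Adj u v → r u v

/-- The moral graph: the skeleton, with an edge added between any two vertices that have a common
child. -/
def DAG.moral {V : Type*} (G : DAG V) : SimpleGraph V where
  Adj u v := u ≠ v ∧ (G.Adj u v ∨ G.Adj v u ∨ ∃ w, G.Adj u w ∧ G.Adj v w)
  symm := ⟨fun _ _ h => ⟨h.1.symm, h.2.elim (fun h => Or.inr (Or.inl h)) fun h =>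
    h.elim (fun h => Or.inl h) fun ⟨w, h1, h2⟩ => Or.inr (Or.inr ⟨w, h2, h1⟩)⟩⟩

/-- The subgraph `G_A` induced by `A`. -/
def DAG.induce {V : Type*} (G : DAG V) (A : Finset V) : DAG A where
  Adj u v := G.Adj u v
  acyclic := by
    obtain ⟨r, hr, h⟩ := G.acyclic
    exact ⟨_, (Subrel.relEmbedding r (· ∈ A)).isWellOrder, fun u v huv => h u v huv⟩

/-- `A` is ancestral in `G`: it contains the parents of each of its elements. -/
def DAG.IsAncestral {V : Type*} (G : DAG V) (A : Finset V) : Prop :=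
  ∀ v ∈ A, ∀ u, G.Adj u v → u ∈ A

/-- A graph `G` in which every two distinct vertices are joined by an edge. -/
def DAG.IsComplete {V : Type*} (G : DAG V) : Prop :=
  ∀ u v, u ≠ v → G.Adj u v ∨ G.Adj v u

/-- The insertion `H ⋉ G` of a DAG `H` on the ancestral set `A` of `G` into `G`: the edges between
elements of `A` are those of `H`, all other edges are those of `G`. -/
def DAG.insertion {V : Type*} {A : Finset V} (H : DAG A) (G : DAG V) (hA : G.IsAncestral A) :
    DAG V where
  Adj u v := (∃ (hu : u ∈ A) (hv : v ∈ A), H.Adj ⟨u, hu⟩ ⟨v, hv⟩) ∨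
    (G.Adj u v ∧ ¬ (u ∈ A ∧ v ∈ A))
  acyclic := by
    classical
    obtain ⟨r, hr, h⟩ := G.acyclic
    obtain ⟨s, hs, k⟩ := H.acyclic
    let f : V → A ⊕ V := fun v => if hv : v ∈ A then Sum.inl ⟨v, hv⟩ else Sum.inr v
    have hf : Function.Injective f := by
      intro u v huv
      by_cases hu : u ∈ A <;> by_cases hv : v ∈ A <;> simp_all [f]
    refine ⟨_, (RelEmbedding.preimage ⟨f, hf⟩ (Sum.Lex s r)).isWellOrder, ?_⟩
    rintro u v (⟨hu, hv, huv⟩ | ⟨huv, hn⟩)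
    · simpa [f, hu, hv] using k _ _ huv
    · have hv : v ∉ A := fun hv => hn ⟨hA v hv u huv, hv⟩
      by_cases hu : u ∈ A
      · simp [f, hu, hv]
      · simpa [f, hu, hv] using h _ _ huv

open Classical in
/-- The parents of `v` in `G`. -/
noncomputable def DAG.parents {V : Type*} [Fintype V] (G : DAG V) (v : V) : Finset V :=
  Finset.univ.filter fun u => G.Adj u v

open Classical in
/-- The smallest ancestral set of `G` that contains `S`. -/
noncomputable def DAG.ancestralHull {V : Type*} [Fintype V] (G : DAG V) (S : Finset V) :
    Finset V :=
  Finset.univ.filter fun v => ∀ T : Finset V, G.IsAncestral T → S ⊆ T → v ∈ T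

/-- `A` and `B` are separated by `C` in the undirected graph `K`: every walk from an element of `A`
to an element of `B` (possibly of length zero) contains an element of `C`. -/
def SimpleGraph.SeparatedBy {W : Type*} (K : SimpleGraph W) (A B C : Set W) : Prop :=
  ∀ a ∈ A, ∀ b ∈ B, ∀ p : K.Walk a b, ∃ c ∈ p.support, c ∈ C

/-- The semi-graphoid of `G`: the triples `⟨A, B | C⟩` such that `A` and `B` are separated by `C` in
the moral graph of the subgraph induced by the smallest ancestral set containing `A ∪ B ∪ C`. -/
def DAG.semigraphoid {V : Type*} [Fintype V] [DecidableEq V] (G : DAG V) :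
    Set (Finset V × Finset V × Finset V) :=
  {T | (G.induce (G.ancestralHull (T.1 ∪ T.2.1 ∪ T.2.2))).moral.SeparatedBy
    {x | x.1 ∈ T.1} {x | x.1 ∈ T.2.1} {x | x.1 ∈ T.2.2}}

/-- Markov equivalence: equality of semi-graphoids. -/
def DAG.markovSetoid (V : Type*) [Fintype V] [DecidableEq V] : Setoid (DAG V) where
  r G G' := G.semigraphoid = G'.semigraphoid
  iseqv := ⟨fun _ => rfl, fun h => h.symm, fun h h' => h.trans h'⟩

/-- A dagoid is a Markov equivalence class of directed acyclic graphs. -/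
def Dagoid (V : Type*) [Fintype V] [DecidableEq V] : Type _ :=
  Quotient (DAG.markovSetoid V)

/-- The Markov equivalence class `[G]`. -/
def DAG.dagoid {V : Type*} [Fintype V] [DecidableEq V] (G : DAG V) : Dagoid V :=
  Quotient.mk (DAG.markovSetoid V) G

instance Dagoid.instMembership {V : Type*} [Fintype V] [DecidableEq V] :
    Membership (DAG V) (Dagoid V) :=
  ⟨fun D G => G.dagoid = D⟩

/-- `A` is ancestral in the dagoid `D`: it is ancestral in some graph `G ∈ D`. -/
def Dagoid.IsAncestral {V : Type*} [Fintype V] [DecidableEq V] (D : Dagoid V) (A : Finset V) :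
    Prop :=
  ∃ G ∈ D, G.IsAncestral A

/-- `E` is the subdagoid `D_A` of `D` induced by `A`: the class of `G_A`, for a graph `G ∈ D` in
which `A` is ancestral. -/
def Dagoid.IsSubdagoid {V : Type*} [Fintype V] [DecidableEq V] (D : Dagoid V) (A : Finset V)
    (E : Dagoid A) : Prop :=
  ∃ G ∈ D, G.IsAncestral A ∧ (G.induce A).dagoid = E

/-- `R` is the remainder dagoid `D_{V|A}` of `D` given `A`: the class of `C ⋉ G`, for a graph
`G ∈ D` in which `A` is ancestral and a complete graph `C` on `A`. -/
def Dagoid.IsRemainder {V : Type*} [Fintype V] [DecidableEq V] (D : Dagoid V) (A : Finset V)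
    (R : Dagoid V) : Prop :=
  ∃ G ∈ D, ∃ hA : G.IsAncestral A, ∃ C : DAG A, C.IsComplete ∧ (C.insertion G hA).dagoid = R

/-- The vector `δ(A) = (1_{S = A})_{S ⊆ V}`. -/
def deltaVec {V : Type*} [DecidableEq V] (A : Finset V) : Finset V → ℤ :=
  fun S => if S = A then 1 else 0

/-- The d-clique vector `t(G) = ∑ v, [δ({v} ∪ pa(v)) - δ(pa(v))] + δ(∅)`. -/
noncomputable def DAG.dCliqueVector {V : Type*} [Fintype V] [DecidableEq V] (G : DAG V) :
    Finset V → ℤ :=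
  (∑ v, (deltaVec ({v} ∪ G.parents v) - deltaVec (G.parents v))) + deltaVec ∅

/-- The expansion `[x]^0` with zeroes of a vector indexed by the subsets of `A` to one indexed by
the subsets of `V`. -/
def zeroExtend {V : Type*} [DecidableEq V] (A : Finset V) (x : Finset A → ℤ) : Finset V → ℤ :=
  fun S => if S ⊆ A then x (S.subtype (· ∈ A)) else 0

/-! Summing a vector over supersets is injective (`supersetSum_injective`), so it suffices to
compare superset sums. Those of `t(G)` form the 0/1 indicator of the d-cliques of `G`
(`DAG.supersetSum_dCliqueVector`), and d-cliques can be read off the semi-graphoid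
(`DAG.isDClique_iff_semigraphoid`), so no choice of representative matters. At `S ⊆ A` the subdagoid
has the same indicator as `D`, while the remainder contributes 1, cancelled by `δ(A)`. At any other
`S` the subdagoid and `δ(A)` contribute 0, and the remainder agrees with `D`. -/

/-- The indicator of the sets `S` that are empty or consist of a vertex `v` and some of its parents:
the superset sums of the d-clique vector. -/
def DAG.IsDClique {V : Type*} (G : DAG V) (S : Finset V) : Prop :=
  S.Nonempty → ∃ v ∈ S, ∀ u ∈ S, u ≠ v → G.Adj u v

theorem DAG.not_adj_self {V : Type*} (G : DAG V) (v : V) : ¬ G.Adj v v := by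
  obtain ⟨r, hr, h⟩ := G.acyclic
  exact fun hv => irrefl_of r v (h v v hv)

theorem DAG.not_adj_symm {V : Type*} (G : DAG V) {u v : V} (huv : G.Adj u v) : ¬ G.Adj v u := by
  obtain ⟨r, hr, h⟩ := G.acyclic
  exact fun hvu => irrefl_of r v (trans_of r (h v u hvu) (h u v huv))

/-- A nonempty finite set has a last element with respect to a strict well-ordering. -/
theorem Finset.exists_last {V : Type*} (r : V → V → Prop) [IsWellOrder V r] {S : Finset V}
    (hS : S.Nonempty) : ∃ v ∈ S, ∀ u ∈ S, ¬ r v u := by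
  classical
  induction hS using Finset.Nonempty.cons_induction with
  | singleton a => exact ⟨a, by simp, by simpa using irrefl_of r a⟩
  | cons a s ha hs ih =>
    obtain ⟨v, hv, h⟩ := ih
    by_cases hva : r v a
    · refine ⟨a, by simp, fun u hu hau => ?_⟩
      rcases Finset.mem_cons.1 hu with rfl | hu
      · exact irrefl_of r _ hau
      · exact h u hu (trans_of r hva hau)
    · refine ⟨v, by simp [hv], fun u hu => ?_⟩
      rcases Finset.mem_cons.1 hu with rfl | hu
      · exact hva
      · exact h u hu

theorem DAG.IsComplete.isDClique {V : Type*} {G : DAG V} (hG : G.IsComplete) (S : Finset V) :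
    G.IsDClique S := by
  intro hS
  obtain ⟨r, hr, h⟩ := G.acyclic
  obtain ⟨v, hv, hmax⟩ := Finset.exists_last r hS
  exact ⟨v, hv, fun u hu huv => (hG u v huv).resolve_right fun hvu => hmax u hu (h _ _ hvu)⟩

theorem DAG.exists_isComplete (V : Type*) : ∃ G : DAG V, G.IsComplete := by
  refine ⟨⟨WellOrderingRel, WellOrderingRel, inferInstance, fun _ _ h => h⟩, fun u v huv => ?_⟩
  rcases trichotomous_of WellOrderingRel u v with h | h | h
  · exact Or.inl h
  · exact absurd h huv
  · exact Or.inr h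

theorem DAG.isDClique_induce {V : Type*} [DecidableEq V] (G : DAG V) {A S : Finset V}
    (hS : S ⊆ A) : (G.induce A).IsDClique (S.subtype (· ∈ A)) ↔ G.IsDClique S := by
  constructor
  · rintro h ⟨x, hx⟩
    obtain ⟨v, hv, h⟩ := h ⟨⟨x, hS hx⟩, by simpa using hx⟩
    exact ⟨v, by simpa using hv, fun u hu huv =>
      h ⟨u, hS hu⟩ (by simpa using hu) fun e => huv (congrArg Subtype.val e)⟩
  · rintro h ⟨x, hx⟩
    obtain ⟨v, hv, h⟩ := h ⟨x, by simpa using hx⟩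
    exact ⟨⟨v, hS hv⟩, by simpa using hv, fun u hu huv =>
      h u (by simpa using hu) fun e => huv (Subtype.ext e)⟩

theorem DAG.isDClique_insertion_of_subset {V : Type*} {A S : Finset V} {C : DAG A}
    (hC : C.IsComplete) (G : DAG V) (hA : G.IsAncestral A) (hS : S ⊆ A) :
    (C.insertion G hA).IsDClique S := by
  classical
  rintro ⟨x, hx⟩
  obtain ⟨v, hv, h⟩ := hC.isDClique (S.subtype (· ∈ A)) ⟨⟨x, hS hx⟩, by simpa using hx⟩
  exact ⟨v, by simpa using hv, fun u hu huv => Or.inl ⟨hS hu, v.2,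
    h ⟨u, hS hu⟩ (by simpa using hu) fun e => huv (congrArg Subtype.val e)⟩⟩

/-- Since `A` is ancestral, the vertex of `S` that receives edges from all the others must lie
outside `A`, and insertion leaves the edges into such a vertex unchanged. -/
theorem DAG.isDClique_insertion_of_not_subset {V : Type*} {A S : Finset V} (C : DAG A)
    (G : DAG V) (hA : G.IsAncestral A) (hS : ¬ S ⊆ A) :
    (C.insertion G hA).IsDClique S ↔ G.IsDClique S := by
  obtain ⟨x, hxS, hxA⟩ := Finset.not_subset.1 hS
  constructor <;> intro h hne <;> obtain ⟨v, hv, h⟩ := h hne <;> refine ⟨v, hv, fun u hu huv => ?_⟩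
  · have hvA : v ∉ A := by
      intro hvA
      rcases h x hxS (fun e => hxA (e ▸ hvA)) with ⟨hx, _⟩ | ⟨hx, _⟩
      · exact hxA hx
      · exact hxA (hA v hvA x hx)
    rcases h u hu huv with ⟨_, hv', _⟩ | ⟨h, _⟩
    · exact absurd hv' hvA
    · exact h
  · have hvA : v ∉ A := fun hvA => hxA (hA v hvA x (h x hxS fun e => hxA (e ▸ hvA)))
    exact Or.inr ⟨h u hu huv, fun e => hvA e.2⟩

/-! ### Ancestral hulls and the recovery of d-cliques from separation -/

section Hull

variable {V : Type*} [Fintype V]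

theorem DAG.subset_ancestralHull (G : DAG V) (S : Finset V) : S ⊆ G.ancestralHull S := by
  intro x hx
  simpa [DAG.ancestralHull] using fun T _ hT => hT hx

theorem DAG.ancestralHull_subset {G : DAG V} {S T : Finset V} (hT : G.IsAncestral T)
    (hST : S ⊆ T) : G.ancestralHull S ⊆ T := by
  intro x hx
  simp only [DAG.ancestralHull, Finset.mem_filter, Finset.mem_univ, true_and] at hx
  exact hx T hT hST

theorem DAG.isAncestral_ancestralHull (G : DAG V) (S : Finset V) :
    G.IsAncestral (G.ancestralHull S) := by
  intro v hv u huv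
  simp only [DAG.ancestralHull, Finset.mem_filter, Finset.mem_univ, true_and] at hv ⊢
  exact fun T hT hST => hT v (hv T hT hST) u huv

/-- The d-cliques are the sets no two of whose elements are separated by a superset of the
others. -/
theorem DAG.isDClique_iff_semigraphoid [DecidableEq V] (G : DAG V) (S : Finset V) :
    G.IsDClique S ↔ ∀ a ∈ S, ∀ b ∈ S, a ≠ b → ∀ C : Finset V, S \ {a, b} ⊆ C → a ∉ C → b ∉ C →
      (({a}, {b}, C) : Finset V × Finset V × Finset V) ∉ G.semigraphoid := by
  constructor
  · intro h a ha b hb hab C hSC haC hbC hsep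
    obtain ⟨v, hv, h⟩ := h ⟨a, ha⟩
    have hsub := G.subset_ancestralHull ({a} ∪ {b} ∪ C)
    have hadj : (G.induce (G.ancestralHull ({a} ∪ {b} ∪ C))).moral.Adj
        ⟨a, hsub (by simp)⟩ ⟨b, hsub (by simp)⟩ := by
      refine ⟨fun e => hab (congrArg Subtype.val e), ?_⟩
      -- Either one of `a`, `b` is the common child `v` of the rest of `S`, or `v` lies in `C` and
      -- the moral graph marries its parents `a` and `b`.
      by_cases hav : a = v
      · subst hav
        exact Or.inr (Or.inl (h b hb hab.symm))
      by_cases hbv : b = v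
      · subst hbv
        exact Or.inl (h a ha hab)
      · have hvC : v ∈ C := hSC (by simp [hv, Ne.symm hav, Ne.symm hbv])
        exact Or.inr (Or.inr ⟨⟨v, hsub (by simp [hvC])⟩, h a ha hav, h b hb hbv⟩)
    obtain ⟨c, hc, hcC⟩ := hsep ⟨a, hsub (by simp)⟩ (Finset.mem_singleton_self a)
      ⟨b, hsub (by simp)⟩ (Finset.mem_singleton_self b)
      hadj.toWalk
    simp only [SimpleGraph.Walk.support_cons, SimpleGraph.Walk.support_nil,
      List.mem_cons, List.not_mem_nil, or_false] at hc
    rcases hc with rfl | rfl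
    · exact haC hcC
    · exact hbC hcC
  · intro h hS
    classical
    obtain ⟨r, hr, hGr⟩ := G.acyclic
    obtain ⟨v, hv, hmax⟩ := Finset.exists_last r hS
    refine ⟨v, hv, fun u hu huv => ?_⟩
    -- With everything in the hull of `S` except `u`, `v` as separator, a walk that avoids it can
    -- visit only `u` and `v`, so its first step is a moral edge between them.
    have hN : G.ancestralHull ({u} ∪ {v} ∪ G.ancestralHull S \ {u, v}) ⊆ G.ancestralHull S := by
      refine DAG.ancestralHull_subset (G.isAncestral_ancestralHull S) fun x hx => ?_
      simp only [Finset.mem_union, Finset.mem_singleton, Finset.mem_sdiff] at hx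
      rcases hx with (rfl | rfl) | hx
      · exact G.subset_ancestralHull S hu
      · exact G.subset_ancestralHull S hv
      · exact hx.1
    have hns := h u hu v hv huv (G.ancestralHull S \ {u, v})
      (Finset.sdiff_subset_sdiff (G.subset_ancestralHull S) subset_rfl) (by simp) (by simp)
    simp only [DAG.semigraphoid, SimpleGraph.SeparatedBy, Set.mem_ofPred_eq, not_forall,
      not_exists, not_and, Finset.mem_singleton] at hns
    obtain ⟨⟨a, haN⟩, ha, ⟨b, hbN⟩, hb, p, hp⟩ := hns
    obtain rfl : a = u := ha
    obtain rfl : b = v := hb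
    cases p with
    | nil => exact absurd rfl huv
    | @cons _ w _ hadj q =>
      obtain ⟨w, hwN⟩ := w
      have hw := hp ⟨w, hwN⟩ (List.mem_cons_of_mem _ q.start_mem_support)
      have hwb : w = b := by
        have h1 : w ≠ a := fun e => hadj.1 (Subtype.ext e.symm)
        by_contra h2
        exact hw (by simp [hN hwN, h1, h2])
      subst hwb
      rcases hadj.2 with h1 | h1 | ⟨⟨x, hxN⟩, -, h1⟩
      · exact h1
      · exact absurd (hGr _ _ h1) (hmax a hu)
      -- A common child is impossible: the vertices not after the last element of `S` form an
      -- ancestral set containing `S`, hence its hull.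
      · have hsub : G.ancestralHull S ⊆ Finset.univ.filter fun x => ¬ r w x := by
          refine DAG.ancestralHull_subset (fun y hy z hz => ?_) fun y hy => by simpa using hmax y hy
          simp only [Finset.mem_filter, Finset.mem_univ, true_and] at hy ⊢
          exact fun hwz => hy (trans_of r hwz (hGr _ _ hz))
        have := hsub (hN hxN)
        simp only [Finset.mem_filter, Finset.mem_univ, true_and] at this
        exact absurd (hGr _ _ h1) this

end Hull

/-! ### Superset sums -/

section Zeta

variable {V : Type*} [Fintype V] [DecidableEq V]

/-- The sums of a vector over the supersets of a set. -/
def supersetSum (x : Finset V → ℤ) (S : Finset V) : ℤ :=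
  ∑ T with S ⊆ T, x T

/-- The transform is unitriangular for inclusion, so entries are recovered from the largest sets
downwards. -/
theorem supersetSum_injective : Function.Injective (supersetSum (V := V)) := by
  intro x y hxy
  ext S
  induction S using WellFoundedGT.induction with
  | ind S ih =>
    have h := congrFun hxy S
    have hS : S ∈ Finset.univ.filter fun T : Finset V => S ⊆ T := by simp
    rw [supersetSum, supersetSum, ← Finset.add_sum_erase _ _ hS, ← Finset.add_sum_erase _ _ hS,
      Finset.sum_congr rfl fun T hT => ih T ?_] at h
    · exact add_right_cancel h
    · simp only [Finset.mem_erase, Finset.mem_filter, Finset.mem_univ, true_and] at hT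
      exact lt_of_le_of_ne hT.2 hT.1.symm

theorem supersetSum_add (x y : Finset V → ℤ) (S : Finset V) :
    supersetSum (x + y) S = supersetSum x S + supersetSum y S := by
  simp [supersetSum, Finset.sum_add_distrib]

theorem supersetSum_sub (x y : Finset V → ℤ) (S : Finset V) :
    supersetSum (x - y) S = supersetSum x S - supersetSum y S := by
  simp [supersetSum, Finset.sum_sub_distrib]

theorem supersetSum_sum {ι : Type*} (s : Finset ι) (x : ι → Finset V → ℤ) (S : Finset V) :
    supersetSum (∑ i ∈ s, x i) S = ∑ i ∈ s, supersetSum (x i) S := by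
  simp only [supersetSum, Finset.sum_apply]
  exact Finset.sum_comm

theorem supersetSum_deltaVec (A S : Finset V) :
    supersetSum (deltaVec A) S = if S ⊆ A then 1 else 0 := by
  simp [supersetSum, deltaVec, Finset.sum_ite_eq']

theorem supersetSum_zeroExtend (A : Finset V) (x : Finset A → ℤ) (S : Finset V) :
    supersetSum (zeroExtend A x) S =
      if S ⊆ A then supersetSum x (S.subtype (· ∈ A)) else 0 := by
  split_ifs with hS
  · simp only [supersetSum, zeroExtend]
    rw [← Finset.sum_filter, Finset.filter_filter]
    refine Finset.sum_bij' (fun T _ => T.subtype (· ∈ A))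
      (fun T _ => T.map (Function.Embedding.subtype _)) ?_ ?_ ?_ ?_ ?_
    · intro T hT
      simp only [Finset.mem_filter, Finset.mem_univ, true_and] at hT ⊢
      exact fun a ha => Finset.mem_subtype.2 (hT.1 (Finset.mem_subtype.1 ha))
    · intro T hT
      simp only [Finset.mem_filter, Finset.mem_univ, true_and] at hT ⊢
      refine ⟨fun a ha => ?_, Finset.map_subtype_subset T⟩
      exact Finset.mem_map.2 ⟨⟨a, hS ha⟩, hT (by simpa using ha), rfl⟩
    · intro T hT
      simp only [Finset.mem_filter, Finset.mem_univ, true_and] at hT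
      exact Finset.subtype_map_of_mem fun a ha => hT.2 ha
    · intro T _
      ext a
      simp
    · intro T _
      rfl
  · refine Finset.sum_eq_zero fun T hT => if_neg fun hTA => hS ?_
    simp only [Finset.mem_filter, Finset.mem_univ, true_and] at hT
    exact hT.trans hTA

open Classical in
theorem DAG.supersetSum_dCliqueVector (G : DAG V) (S : Finset V) :
    supersetSum G.dCliqueVector S = if G.IsDClique S then 1 else 0 := by
  rw [DAG.dCliqueVector, supersetSum_add, supersetSum_sum]
  simp only [supersetSum_sub, supersetSum_deltaVec]
  -- At `S = ∅` every vertex term is 1 - 1, and only `δ(∅)` contributes.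
  rcases S.eq_empty_or_nonempty with rfl | hS
  · simp [DAG.IsDClique]
  have hterm (v : V) : ((if S ⊆ {v} ∪ G.parents v then 1 else 0) -
      (if S ⊆ G.parents v then 1 else 0) : ℤ) =
      if v ∈ S ∧ ∀ u ∈ S, u ≠ v → G.Adj u v then 1 else 0 := by
    have h1 : S ⊆ {v} ∪ G.parents v ↔ ∀ u ∈ S, u ≠ v → G.Adj u v := by
      simp [Finset.subset_iff, DAG.parents, or_iff_not_imp_left]
    have h2 : S ⊆ G.parents v ↔ v ∉ S ∧ ∀ u ∈ S, u ≠ v → G.Adj u v := by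
      simp only [Finset.subset_iff, DAG.parents, Finset.mem_filter, Finset.mem_univ, true_and]
      refine ⟨fun h => ⟨fun hv => G.not_adj_self v (h hv), fun u hu _ => h hu⟩, ?_⟩
      exact fun h u hu => h.2 u hu fun e => h.1 (e ▸ hu)
    simp only [h1, h2]
    by_cases hv : v ∈ S <;> simp [hv]
  simp only [hterm, Finset.subset_empty, hS.ne_empty, if_false, add_zero]
  split_ifs with h
  · obtain ⟨v, hv⟩ := h hS
    rw [Finset.sum_eq_single v, if_pos hv]
    · intro w _ hwv
      -- Two such vertices would be parents of each other.
      exact if_neg fun hw => G.not_adj_symm (hv.2 w hw.1 hwv) (hw.2 v hv.1 hwv.symm)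
    · simp
  · exact Finset.sum_eq_zero fun v _ => if_neg fun hv => h fun _ => ⟨v, hv⟩

end Zeta

theorem DAG.isDClique_iff_of_mem {V : Type*} [Fintype V] [DecidableEq V] {D : Dagoid V}
    {G G' : DAG V} (hG : G ∈ D) (hG' : G' ∈ D) (S : Finset V) :
    G.IsDClique S ↔ G'.IsDClique S := by
  have h : G.semigraphoid = G'.semigraphoid := Quotient.exact (Eq.trans hG (Eq.symm hG'))
  rw [G.isDClique_iff_semigraphoid, G'.isDClique_iff_semigraphoid, h]

theorem mainTheorem7 {V : Type*} [Fintype V] [DecidableEq V] (D : Dagoid V) (A : Finset V)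
    (hA : D.IsAncestral A) :
    (∃ E : Dagoid A, D.IsSubdagoid A E) ∧ (∃ R : Dagoid V, D.IsRemainder A R) ∧
      ∀ (E : Dagoid A) (R : Dagoid V), D.IsSubdagoid A E → D.IsRemainder A R →
        ∀ G ∈ D, ∀ H ∈ E, ∀ K ∈ R,
          G.dCliqueVector = zeroExtend A H.dCliqueVector + K.dCliqueVector - deltaVec A := by
  classical
  refine ⟨?_, ?_, ?_⟩
  · obtain ⟨G, hG, hGA⟩ := hA
    exact ⟨_, G, hG, hGA, rfl⟩
  · obtain ⟨G, hG, hGA⟩ := hA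
    obtain ⟨C, hC⟩ := DAG.exists_isComplete A
    exact ⟨_, G, hG, hGA, C, hC, rfl⟩
  · rintro E R ⟨G₁, hG₁, -, hE⟩ ⟨G₂, hG₂, hA₂, C, hC, hR⟩ G hG H hH K hK
    apply supersetSum_injective
    funext S
    rw [supersetSum_sub, supersetSum_add, supersetSum_zeroExtend, supersetSum_deltaVec,
      G.supersetSum_dCliqueVector, H.supersetSum_dCliqueVector, K.supersetSum_dCliqueVector]
    have hKS := DAG.isDClique_iff_of_mem hK hR S
    by_cases hS : S ⊆ A
    · have hHS := (DAG.isDClique_iff_of_mem hH hE (S.subtype (· ∈ A))).trans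
        ((G₁.isDClique_induce hS).trans (DAG.isDClique_iff_of_mem hG₁ hG S))
      simp [hS, hHS, hKS.2 (DAG.isDClique_insertion_of_subset hC G₂ hA₂ hS)]
    · have hGS := hKS.trans ((DAG.isDClique_insertion_of_not_subset C G₂ hA₂ hS).trans
        (DAG.isDClique_iff_of_mem hG₂ hG S))
      simp [hS, hGS]
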